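/- **Notation.** Let $\mathbb F_q$ be a finite field with $q$ elements, fix a nontrivial homomorphism $\vartheta:\mathbb F_q^+\to\mathbb C^\times$, and let $K\subseteq L\subseteq\mathbb Z_{\ge 1}$ be finite sets. Let $U_L$ be the group of unipotent upper-triangular matrices over $\mathbb F_q$ with rows and columns indexed by $L$, and let $U_K\subseteq U_L$ be the subgroup of those $u$ with $u_{ij}=0$ for all $i<j$ unless $i,j\in K$. An *arc* of $L$ is a triple $i\overset{a}{\frown}l$ with $i,l\in L$, $i<l$ and a label $a\in\mathbb F_q^\times$. A *$q$-set partition* of $L$ is a finite set of arcs of $L$ such that any two distinct arcs in it have distinct left ends and distinct right ends. The *superclass* of $U_L$ indexed by a $q$-set partition $\mu$ of $L$ is the set of all $u\in U_L$ with $u-1=x\,N_\mu\,y$ for some $x,y\in U_L$, where $N_\mu=\sum_{j\overset{b}{\frown}k\in\mu} b\,E_{jk}$ and $E_{jk}$ is the matrix unit; each $u\in U_L$ lies in exactly one superclass. The character $\chi^{i\overset{a}{\frown}l}$ of $U_L$ takes, on the superclass indexed by $\mu$, the value $0$ if $\mu$ contains an arc $j\overset{b}{\frown}k$ with $i=j<k<l$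 or $i<j<k=l$, and otherwise the value $$\frac{q^{|\{j\in L\,:\,i<j<l\}|}}{q^{|\{j\overset{b}{\frown}k\in\mu\,:\,i<j<k<l\}|}}\;\vartheta\Big(a\sum_{i\overset{b}{\frown}l\in\mu}b\Big).$$ For a $q$-set partition $\lambda$ of $L$, the supercharacter $\chi^\lambda$ of $U_L$ is the product of the characters $\chi^{i\overset{a}{\frown}l}$ over all arcs $i\overset{a}{\frown}l\in\lambda$. Let $\Gamma_K(\lambda)$ be the bipartite graph whose vertices are $V_\bullet$, the set of arcs of $\lambda$ with both ends in $K$, and $V_\circ$, the set of arcs of $\lambda$ with both ends outside $K$, with an edge between $j\overset{b}{\frown}k\in V_\bullet$ and $i\overset{a}{\frown}l\in V_\circ$ exactly when $i<j<k<l$. **Theorem 3.1.** Let $K\subseteq L\subseteq\mathbb Z_{\ge1}$ be finite sets and let $\lambda$ be a $q$-set partition of $L$. Then $$\big\langle \mathrm{Res}^{U_L}_{U_K}(\chi^\lambda),\mathbb 1\big\rangle\neq 0$$ if and only if $\Gamma_K(\lambda)$ has a matching that covers every vertex of $V_\bullet$ (vertices of $V_\circ$ may remain unmatched). Here $\mathbb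 1$ is the trivial character of $U_K$ and $\langle\phi,\psi\rangle=\frac1{|U_K|}\sum_{u\in U_K}\phi(u)\overline{\psi(u)}$. -/

import Mathlib

noncomputable section

namespace Supercharacter

/-- A labelled arc `i —a— l`: two nodes `i < l` and a nonzero label `a`. -/
@[ext]
structure Arc (ι F : Type*) [LT ι] [Zero F] where
  left : ι
  right : ι
  label : F
  lt : left < right
  label_ne : label ≠ 0

/-- A finite set `lam` of arcs is a `q`-set partition if two distinct arcs of it have distinct left
ends and distinct right ends. (In particular no arc can be repeated, so that a set of arcs rather
than a multiset is enough.) -/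
def IsQSetPartition {ι F : Type*} [LT ι] [Zero F] (lam : Finset (Arc ι F)) : Prop :=
  ∀ a ∈ lam, ∀ b ∈ lam, a ≠ b → a.left ≠ b.left ∧ a.right ≠ b.right

section Groups

variable {ι : Type*} [Fintype ι] [LinearOrder ι] {F : Type*} [Field F]

variable (ι F) in
/-- The group of unipotent upper-triangular matrices over `F` whose rows and columns are indexed by
the finite linearly ordered set `ι`. -/
def U : Subgroup (GL ι F) where
  carrier := {g | (∀ i, g.val i i = 1) ∧ ∀ i j, j < i → g.val i j = 0}
  one_mem' := ⟨fun i => by simp, fun i j h => by simp [h.ne']⟩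
  mul_mem' := by
    rintro g h ⟨hg1, hg0⟩ ⟨hh1, hh0⟩
    refine ⟨fun i => ?_, fun i j hij => ?_⟩
    · rw [Units.val_mul, Matrix.mul_apply, Finset.sum_eq_single i]
      · rw [hg1, hh1, one_mul]
      · intro k _ hk
        rcases lt_or_gt_of_ne hk with h' | h'
        · rw [hg0 _ _ h', zero_mul]
        · rw [hh0 _ _ h', mul_zero]
      · simp
    · rw [Units.val_mul, Matrix.mul_apply]
      refine Finset.sum_eq_zero fun k _ => ?_
      rcases lt_or_ge k i with h' | h'
      · rw [hg0 _ _ h', zero_mul]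
      · rw [hh0 _ _ (hij.trans_le h'), mul_zero]
  inv_mem' := by
    rintro g ⟨hg1, hg0⟩
    have htri : Matrix.BlockTriangular (g⁻¹).val id := by
      rw [Matrix.coe_units_inv]
      have : Invertible g.val := g.invertible
      exact Matrix.blockTriangular_inv_of_blockTriangular fun i j h => hg0 i j h
    have hinv0 : ∀ i j, j < i → (g⁻¹).val i j = 0 := fun i j h => htri h
    refine ⟨fun i => ?_, hinv0⟩
    have h1 : (g.val * (g⁻¹).val) i i = 1 := by
      rw [← Units.val_mul, mul_inv_cancel]; simp
    rw [Matrix.mul_apply, Finset.sum_eq_single i, hg1, one_mul] at h1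
    · exact h1
    · intro k _ hk
      rcases lt_or_gt_of_ne hk with h' | h'
      · rw [hg0 _ _ h', zero_mul]
      · rw [hinv0 _ _ h', mul_zero]
    · simp

/-- The matrix underlying an element of the unitriangular group. -/
def toMat (u : U ι F) : Matrix ι ι F := u.val.val

lemma toMat_one : toMat (1 : U ι F) = 1 := rfl

lemma toMat_mul (u v : U ι F) : toMat (u * v) = toMat u * toMat v := rfl

lemma toMat_diag (u : U ι F) (i : ι) : toMat u i i = 1 := u.2.1 i

lemma toMat_below (u : U ι F) {i j : ι} (h : j < i) : toMat u i j = 0 := u.2.2 i j h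

variable (F) in
/-- For a set `K` of indices, the subgroup of those unipotent upper-triangular matrices `u` for
which `u i j = 0` for all `i < j`, unless both `i` and `j` lie in `K`. -/
def UK (K : Set ι) : Subgroup (U ι F) where
  carrier := {u | ∀ i j, i < j → ¬ (i ∈ K ∧ j ∈ K) → toMat u i j = 0}
  one_mem' := fun i j h _ => by simp [toMat_one, h.ne]
  mul_mem' := by
    intro u v hu hv i j hij hK
    rw [toMat_mul, Matrix.mul_apply]
    refine Finset.sum_eq_zero fun k _ => ?_
    rcases lt_trichotomy k i with h | h | h
    · rw [toMat_below u h, zero_mul]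
    · rw [h, hv i j hij hK, mul_zero]
    · rcases lt_trichotomy k j with h' | h' | h'
      · by_cases hi : i ∈ K
        · rw [hv k j h' fun hh => hK ⟨hi, hh.2⟩, mul_zero]
        · rw [hu i k h fun hh => hi hh.1, zero_mul]
      · rw [h', hu i j hij hK, zero_mul]
      · rw [toMat_below v h', mul_zero]
  inv_mem' := by
    intro u hu i j hij hK
    by_cases hi : i ∈ K
    · have hj : j ∉ K := fun h => hK ⟨hi, h⟩
      have h1 : (toMat u⁻¹ * toMat u) i j = 0 := by
        rw [← toMat_mul, inv_mul_cancel, toMat_one, Matrix.one_apply_ne hij.ne]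
      rw [Matrix.mul_apply, Finset.sum_eq_single j, toMat_diag, mul_one] at h1
      · exact h1
      · intro k _ hk
        rcases lt_or_gt_of_ne hk with h | h
        · rw [hu k j h fun hh => hj hh.2, mul_zero]
        · rw [toMat_below u h, mul_zero]
      · simp
    · have h1 : (toMat u * toMat u⁻¹) i j = 0 := by
        rw [← toMat_mul, mul_inv_cancel, toMat_one, Matrix.one_apply_ne hij.ne]
      rw [Matrix.mul_apply, Finset.sum_eq_single i, toMat_diag, one_mul] at h1
      · exact h1
      · intro k _ hk
        rcases lt_or_gt_of_ne hk with h | h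
        · rw [toMat_below u h, zero_mul]
        · rw [hu i k h fun hh => hi hh.1, zero_mul]
      · simp

/-- The strictly upper-triangular matrix with entry `b` at `(j, k)` for each arc `j —b— k` of `mu`
and zeros elsewhere. -/
def arcMatrix (mu : Finset (Arc ι F)) : Matrix ι ι F :=
  ∑ c ∈ mu, Matrix.single c.left c.right c.label

/-- `u` lies in the superclass indexed by `mu`: the matrix `u - 1` is in the two-sided orbit of the
matrix of `mu` under the unitriangular group. -/
def InSuperclass (mu : Finset (Arc ι F)) (u : U ι F) : Prop :=
  ∃ x y : U ι F, toMat u - 1 = toMat x * arcMatrix mu * toMat y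

lemma arcMatrix_apply (mu : Finset (Arc ι F)) (i k : ι) :
    arcMatrix mu i k = ∑ c ∈ mu, if c.left = i ∧ c.right = k then c.label else 0 := by
  simp only [arcMatrix, Matrix.sum_apply, Matrix.single_apply]

lemma arcMatrix_of_mem {mu : Finset (Arc ι F)} (hmu : IsQSetPartition mu) {c : Arc ι F}
    (hc : c ∈ mu) : arcMatrix mu c.left c.right = c.label := by
  rw [arcMatrix_apply, Finset.sum_eq_single c]
  · simp
  · intro d hd hdc
    rw [if_neg]
    exact fun h => (hmu d hd c hc hdc).1 h.1
  · exact fun h => absurd hc h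

lemma exists_mem_of_arcMatrix_ne {mu : Finset (Arc ι F)} (hmu : IsQSetPartition mu) {i k : ι}
    (h : arcMatrix mu i k ≠ 0) :
    ∃ c ∈ mu, c.left = i ∧ c.right = k ∧ c.label = arcMatrix mu i k := by
  have h' := h
  rw [arcMatrix_apply] at h'
  obtain ⟨c, hc, hne⟩ := Finset.exists_ne_zero_of_sum_ne_zero h'
  have hlr : c.left = i ∧ c.right = k := by
    by_contra hcon
    exact hne (if_neg hcon)
  refine ⟨c, hc, hlr.1, hlr.2, ?_⟩
  rw [← hlr.1, ← hlr.2, arcMatrix_of_mem hmu hc]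

/-- Entries of a product of a unitriangular matrix and an arc matrix. -/
lemma toMat_mul_arcMatrix {mu : Finset (Arc ι F)} (hmu : IsQSetPartition mu) (x : U ι F)
    {c : Arc ι F} (hc : c ∈ mu) (i : ι) :
    (toMat x * arcMatrix mu) i c.right = toMat x i c.left * c.label := by
  rw [Matrix.mul_apply, Finset.sum_eq_single c.left, arcMatrix_of_mem hmu hc]
  · intro j _ hj
    by_contra hne
    obtain ⟨d, hd, hl, hr, -⟩ := exists_mem_of_arcMatrix_ne hmu (right_ne_zero_of_mul hne)
    by_cases hdc : d = c
    · exact hj (by rw [← hl, hdc])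
    · exact (hmu d hd c hc hdc).2 hr
  · simp

lemma arcMatrix_mul_toMat {mu : Finset (Arc ι F)} (hmu : IsQSetPartition mu) (y : U ι F)
    {c : Arc ι F} (hc : c ∈ mu) (k : ι) :
    (arcMatrix mu * toMat y) c.left k = c.label * toMat y c.right k := by
  rw [Matrix.mul_apply, Finset.sum_eq_single c.right, arcMatrix_of_mem hmu hc]
  · intro j _ hj
    by_contra hne
    obtain ⟨d, hd, hl, hr, -⟩ := exists_mem_of_arcMatrix_ne hmu (left_ne_zero_of_mul hne)
    by_cases hdc : d = c
    · exact hj (by rw [← hr, hdc])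
    · exact (hmu d hd c hc hdc).1 hl
  · simp

lemma subset_of_orbit_eq {mu nu : Finset (Arc ι F)} (hmu : IsQSetPartition mu)
    (hnu : IsQSetPartition nu) {x y : U ι F}
    (h : toMat x * arcMatrix mu = arcMatrix nu * toMat y) : mu ⊆ nu := by
  have key : ∀ k : ι, ∀ c ∈ mu, c.right = k → c ∈ nu := by
    intro k
    induction k using WellFoundedLT.induction with
    | ind k ih =>
      rintro c hc rfl
      have h1 : (arcMatrix nu * toMat y) c.left c.right = c.label := by
        rw [← h, toMat_mul_arcMatrix hmu x hc, toMat_diag, one_mul]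
      have h2 : (arcMatrix nu * toMat y) c.left c.right ≠ 0 := h1 ▸ c.label_ne
      rw [Matrix.mul_apply] at h2
      obtain ⟨m, -, hm⟩ := Finset.exists_ne_zero_of_sum_ne_zero h2
      obtain ⟨d, hd, hdl, rfl, -⟩ := exists_mem_of_arcMatrix_ne hnu (left_ne_zero_of_mul hm)
      have hle : d.right ≤ c.right := by
        by_contra hlt
        exact right_ne_zero_of_mul hm (toMat_below y (not_le.1 hlt))
      rcases hle.eq_or_lt with heq | hlt
      · have h3 : (arcMatrix nu * toMat y) d.left d.right = d.label := by
          rw [arcMatrix_mul_toMat hnu y hd, toMat_diag, mul_one]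
        rw [hdl, heq, h1] at h3
        have hcd : c = d := Arc.ext hdl.symm heq.symm h3
        rw [hcd]
        exact hd
      · exfalso
        have h3 : (toMat x * arcMatrix mu) d.left d.right ≠ 0 := by
          rw [h, arcMatrix_mul_toMat hnu y hd, toMat_diag, mul_one]
          exact d.label_ne
        rw [Matrix.mul_apply] at h3
        obtain ⟨j, -, hj⟩ := Finset.exists_ne_zero_of_sum_ne_zero h3
        obtain ⟨e, he, -, her, -⟩ := exists_mem_of_arcMatrix_ne hmu (right_ne_zero_of_mul hj)
        have henu : e ∈ nu := ih d.right hlt e he her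
        have hed : e = d := by
          by_contra hne
          exact (hnu e henu d hd hne).2 her
        rw [hed] at he
        have hdc : d ≠ c := fun hh => hlt.ne (by rw [hh])
        exact (hmu d he c hc hdc).1 hdl
  exact fun c hc => key _ c hc rfl

/-- The elementary unitriangular matrix `1 + t E_{ij}`, where `i < j`. -/
def elem (i j : ι) (h : i < j) (t : F) : U ι F :=
  ⟨⟨Matrix.transvection i j t, Matrix.transvection i j (-t),
    by rw [Matrix.transvection_mul_transvection_same _ _ h.ne]; simp,
    by rw [Matrix.transvection_mul_transvection_same _ _ h.ne]; simp⟩,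
    fun k => by
      simp only [Matrix.transvection, Matrix.add_apply, Matrix.one_apply_eq, Matrix.single_apply]
      rw [if_neg, add_zero]
      rintro ⟨rfl, rfl⟩
      exact h.ne rfl,
    fun k l hkl => by
      simp only [Matrix.transvection, Matrix.add_apply, Matrix.one_apply_ne hkl.ne',
        Matrix.single_apply]
      rw [if_neg, add_zero]
      rintro ⟨rfl, rfl⟩
      exact lt_asymm h hkl⟩

lemma toMat_elem (i j : ι) (h : i < j) (t : F) :
    toMat (elem i j h t) = Matrix.transvection i j t := rfl

/-- Within the rows in `s`, every row and every column of `N` has at most one nonzero entry. -/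
def GoodOn (s : Finset ι) (N : Matrix ι ι F) : Prop :=
  (∀ i ∈ s, ∀ k l, k < l → N i k ≠ 0 → N i l = 0) ∧
    ∀ i ∈ s, ∀ j ∈ s, i ≠ j → ∀ k, N i k ≠ 0 → N j k = 0

lemma exists_goodOn (N : Matrix ι ι F) (s : Finset ι) :
    ∃ x y : U ι F, GoodOn s (toMat x * N * toMat y) := by
  classical
  induction s using Finset.induction_on_min with
  | empty => exact ⟨1, 1, by simp [GoodOn]⟩
  | insert a s has ih =>
    have hne : ∃ n : ℕ, ∃ x y : U ι F, GoodOn s (toMat x * N * toMat y) ∧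
        (Finset.univ.filter fun k => (toMat x * N * toMat y) a k ≠ 0).card = n := by
      obtain ⟨x, y, hxy⟩ := ih
      exact ⟨_, x, y, hxy, rfl⟩
    obtain ⟨x, y, hgood, hcard⟩ := Nat.find_spec hne
    have hmin : ∀ x' y' : U ι F, GoodOn s (toMat x' * N * toMat y') →
        (Finset.univ.filter fun k => (toMat x * N * toMat y) a k ≠ 0).card ≤
          (Finset.univ.filter fun k => (toMat x' * N * toMat y') a k ≠ 0).card := by
      intro x' y' h'
      rw [hcard]
      exact Nat.find_min' hne ⟨x', y', h', rfl⟩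
    set P := toMat x * N * toMat y with hP
    have hsa : ∀ j ∈ s, j ≠ a := fun j hj => (has j hj).ne'
    -- columns
    have hcol : ∀ j ∈ s, ∀ k, P j k ≠ 0 → P a k = 0 := by
      intro j hj k hjk
      by_contra hak
      have hlt := has j hj
      have hPe : toMat (elem a j hlt (-(P a k / P j k)) * x) * N * toMat y =
          Matrix.transvection a j (-(P a k / P j k)) * P := by
        rw [toMat_mul, toMat_elem, hP]; simp only [Matrix.mul_assoc]
      have hrow : ∀ i, i ≠ a → ∀ l,
          (Matrix.transvection a j (-(P a k / P j k)) * P) i l = P i l :=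
        fun i hi l => Matrix.transvection_mul_apply_of_ne _ _ _ _ hi _ _
      have hm := hmin (elem a j hlt (-(P a k / P j k)) * x) y (by
        rw [hPe]
        refine ⟨fun i hi p l hpl => ?_, fun i hi i' hi' hii p => ?_⟩
        · rw [hrow i (hsa i hi), hrow i (hsa i hi)]
          exact hgood.1 i hi p l hpl
        · rw [hrow i (hsa i hi), hrow i' (hsa i' hi')]
          exact hgood.2 i hi i' hi' hii p)
      rw [hPe] at hm
      refine absurd hm (not_le.2 (Finset.card_lt_card ?_))
      rw [Finset.ssubset_iff_of_subset]
      · refine ⟨k, by simpa using hak, ?_⟩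
        simp only [Finset.mem_filter, Finset.mem_univ, true_and, not_not,
          Matrix.transvection_mul_apply_same]
        field_simp
        ring
      · intro l
        simp only [Finset.mem_filter, Finset.mem_univ, true_and,
          Matrix.transvection_mul_apply_same]
        intro hl hal
        rcases lt_trichotomy k l with h | h | h
        · rw [hal, hgood.1 j hj k l h hjk] at hl
          simp at hl
        · exact hak (h ▸ hal)
        · have hjl : P j l = 0 := by
            by_contra hc
            exact hjk (hgood.1 j hj l k h hc)
          rw [hal, hjl] at hl
          simp at hl
    -- the new row
    have hrow : ∀ k l, k < l → P a k ≠ 0 → P a l = 0 := by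
      intro k l hkl hak
      by_contra hal
      have hPe : toMat x * N * toMat (y * elem k l hkl (-(P a l / P a k))) =
          P * Matrix.transvection k l (-(P a l / P a k)) := by
        rw [toMat_mul, toMat_elem, hP]; simp only [Matrix.mul_assoc]
      have hcol' : ∀ i p, p ≠ l →
          (P * Matrix.transvection k l (-(P a l / P a k))) i p = P i p :=
        fun i p hp => Matrix.mul_transvection_apply_of_ne _ _ _ _ hp _ _
      have hs : ∀ i ∈ s, ∀ p,
          (P * Matrix.transvection k l (-(P a l / P a k))) i p = P i p := by
        intro i hi p
        by_cases hp : p = l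
        · have hik : P i k = 0 := by
            by_contra hc
            exact hak (hcol i hi k hc)
          rw [hp, Matrix.mul_transvection_apply_same, hik, mul_zero, add_zero]
        · exact hcol' i p hp
      have hm := hmin x (y * elem k l hkl (-(P a l / P a k))) (by
        rw [hPe]
        refine ⟨fun i hi p r hpr => ?_, fun i hi i' hi' hii p => ?_⟩
        · rw [hs i hi, hs i hi]
          exact hgood.1 i hi p r hpr
        · rw [hs i hi, hs i' hi']
          exact hgood.2 i hi i' hi' hii p)
      rw [hPe] at hm
      refine absurd hm (not_le.2 (Finset.card_lt_card ?_))
      have hz : (P * Matrix.transvection k l (-(P a l / P a k))) a l = 0 := by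
        rw [Matrix.mul_transvection_apply_same]
        field_simp
        ring
      rw [Finset.ssubset_iff_of_subset]
      · exact ⟨l, by simpa using hal, by simp [hz]⟩
      · intro p
        simp only [Finset.mem_filter, Finset.mem_univ, true_and]
        intro hp
        by_cases hpl : p = l
        · rw [hpl] at hp
          exact absurd hz hp
        · rwa [hcol' a p hpl] at hp
    refine ⟨x, y, ?_, ?_⟩
    · intro i hi k l hkl
      rcases Finset.mem_insert.1 hi with rfl | hi
      · exact hrow k l hkl
      · exact hgood.1 i hi k l hkl
    · intro i hi j hj hij k hik
      rcases Finset.mem_insert.1 hi with rfl | hi'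
      · rcases Finset.mem_insert.1 hj with rfl | hj'
        · exact absurd rfl hij
        · by_contra hc
          exact hik (hcol j hj' k hc)
      · rcases Finset.mem_insert.1 hj with rfl | hj'
        · exact hcol i hi' k hik
        · exact hgood.2 i hi' j hj' hij k hik

/-- A strictly upper-triangular matrix with at most one nonzero entry in each row and in each
column is the matrix of a `q`-set partition. -/
lemma exists_arcMatrix_eq (P : Matrix ι ι F) (hP : GoodOn Finset.univ P)
    (hup : ∀ i j, j ≤ i → P i j = 0) :
    ∃ mu : Finset (Arc ι F), IsQSetPartition mu ∧ arcMatrix mu = P := by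
  classical
  have hlt : ∀ p : ι × ι, P p.1 p.2 ≠ 0 → p.1 < p.2 := fun p hp => by
    by_contra hc
    exact hp (hup _ _ (not_lt.1 hc))
  let f : {p : ι × ι // P p.1 p.2 ≠ 0} → Arc ι F :=
    fun p => ⟨p.1.1, p.1.2, P p.1.1 p.1.2, hlt p.1 p.2, p.2⟩
  have hlab : ∀ c ∈ Finset.univ.image f, P c.left c.right = c.label := by
    intro c hc
    obtain ⟨p, -, rfl⟩ := Finset.mem_image.1 hc
    rfl
  have hq : IsQSetPartition (Finset.univ.image f) := by
    intro c hc d hd hcd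
    have h1 := hlab c hc
    have h2 := hlab d hd
    constructor
    · intro hl
      apply hcd
      have hr : c.right = d.right := by
        rcases lt_trichotomy c.right d.right with h | h | h
        · exact absurd (hP.1 c.left (Finset.mem_univ _) _ _ h (h1 ▸ c.label_ne))
            (by rw [hl, h2]; exact d.label_ne)
        · exact h
        · exact absurd (hP.1 d.left (Finset.mem_univ _) _ _ h (h2 ▸ d.label_ne))
            (by rw [← hl, h1]; exact c.label_ne)
      exact Arc.ext hl hr (by rw [← h1, ← h2, hl, hr])
    · intro hr
      apply hcd
      have hl : c.left = d.left := by
        by_contra hne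
        exact absurd (hP.2 c.left (Finset.mem_univ _) d.left (Finset.mem_univ _) hne c.right
          (h1 ▸ c.label_ne)) (by rw [hr, h2]; exact d.label_ne)
      exact Arc.ext hl hr (by rw [← h1, ← h2, hl, hr])
  refine ⟨Finset.univ.image f, hq, ?_⟩
  ext i k
  by_cases hik : P i k = 0
  · rw [hik]
    by_contra hne
    obtain ⟨c, hc, rfl, rfl, -⟩ := exists_mem_of_arcMatrix_ne hq hne
    exact c.label_ne ((hlab c hc).symm.trans hik)
  · exact arcMatrix_of_mem hq (Finset.mem_image_of_mem f (Finset.mem_univ ⟨(i, k), hik⟩))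

/-- The superclasses are indexed by the `q`-set partitions: every element of the unitriangular group
lies in the superclass indexed by exactly one `q`-set partition. -/
theorem existsUnique_superclass (u : U ι F) :
    ∃! mu : Finset (Arc ι F), IsQSetPartition mu ∧ InSuperclass mu u := by
  obtain ⟨x, y, hgood⟩ := exists_goodOn (toMat u - 1) Finset.univ
  have hu0 : ∀ i j, j ≤ i → (toMat u - 1) i j = 0 := by
    intro i j hij
    rcases hij.eq_or_lt with rfl | h
    · simp [toMat_diag]
    · rw [Matrix.sub_apply, toMat_below u h, Matrix.one_apply_ne h.ne', sub_zero]
  obtain ⟨mu, hmu, hmat⟩ := exists_arcMatrix_eq _ hgood (by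
    intro i j hij
    rw [Matrix.mul_apply]
    refine Finset.sum_eq_zero fun k _ => ?_
    rcases lt_or_ge j k with h | h
    · rw [toMat_below y h, mul_zero]
    · rw [Matrix.mul_apply, Finset.sum_eq_zero, zero_mul]
      intro l _
      rcases lt_or_ge l i with h' | h'
      · rw [toMat_below x h', zero_mul]
      · rw [hu0 l k ((h.trans hij).trans h'), mul_zero])
  have hcancel : ∀ z : U ι F, toMat z⁻¹ * toMat z = 1 := fun z => by
    rw [← toMat_mul, inv_mul_cancel, toMat_one]
  have hcancel' : ∀ z : U ι F, toMat z * toMat z⁻¹ = 1 := fun z => by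
    rw [← toMat_mul, mul_inv_cancel, toMat_one]
  refine ⟨mu, ⟨hmu, x⁻¹, y⁻¹, ?_⟩, ?_⟩
  · rw [hmat]
    calc toMat u - 1 = (toMat x⁻¹ * toMat x) * (toMat u - 1) * (toMat y * toMat y⁻¹) := by
          rw [hcancel, hcancel', one_mul, mul_one]
      _ = _ := by simp only [Matrix.mul_assoc]
  · have hsub : ∀ al be : Finset (Arc ι F), IsQSetPartition al → IsQSetPartition be →
        InSuperclass al u → InSuperclass be u → al ⊆ be := by
      rintro al be hal hbe ⟨x₁, y₁, h₁⟩ ⟨x₂, y₂, h₂⟩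
      refine subset_of_orbit_eq (x := x₂⁻¹ * x₁) (y := y₂ * y₁⁻¹) hal hbe ?_
      calc toMat (x₂⁻¹ * x₁) * arcMatrix al
          = toMat x₂⁻¹ * (toMat x₁ * arcMatrix al * toMat y₁) * toMat y₁⁻¹ := by
            simp only [toMat_mul, Matrix.mul_assoc, hcancel', mul_one]
        _ = toMat x₂⁻¹ * (toMat x₂ * arcMatrix be * toMat y₂) * toMat y₁⁻¹ := by
            rw [← h₁, h₂]
        _ = (toMat x₂⁻¹ * toMat x₂) * arcMatrix be * toMat (y₂ * y₁⁻¹) := by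
            simp only [toMat_mul, Matrix.mul_assoc]
        _ = _ := by rw [hcancel, one_mul]
    rintro nu ⟨hnu, hnuu⟩
    have hmuu : InSuperclass mu u := by
      refine ⟨x⁻¹, y⁻¹, ?_⟩
      rw [hmat]
      calc toMat u - 1 = (toMat x⁻¹ * toMat x) * (toMat u - 1) * (toMat y * toMat y⁻¹) := by
            rw [hcancel, hcancel', one_mul, mul_one]
        _ = _ := by simp only [Matrix.mul_assoc]
    exact Finset.Subset.antisymm (hsub nu mu hnu hmu hnuu hmuu) (hsub mu nu hmu hnu hmuu hnuu)

/-- The `q`-set partition that indexes the superclass of `u`. -/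
def superclassIndex (u : U ι F) : Finset (Arc ι F) :=
  (existsUnique_superclass u).choose

lemma superclassIndex_spec (u : U ι F) :
    IsQSetPartition (superclassIndex u) ∧ InSuperclass (superclassIndex u) u :=
  (existsUnique_superclass u).choose_spec.1

end Groups

section Characters

variable {ι : Type*} [Fintype ι] [LinearOrder ι] {F : Type*} [Field F]

/-- `wt_{il}(mu)`: the sum of the labels of the arcs of `mu` from `i` to `l`. -/
def wt (mu : Finset (Arc ι F)) (i l : ι) : F :=
  ∑ c ∈ mu.filter (fun c => c.left = i ∧ c.right = l), c.label

open Classical in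
/-- The value of the character of the arc `a = (i —a— l)` on the superclass indexed by `mu`: it is
`0` if `mu` has an arc `j —b— k` with `i = j < k < l` or `i < j < k = l`, and otherwise it is
`q ^ #{j | i < j < l} / q ^ #{j —b— k ∈ mu | i < j < k < l} * θ (a * wt_{il}(mu))`,
where `q` is the number of elements of `F`. -/
def arcValue (θ : AddChar F ℂ) (a : Arc ι F) (mu : Finset (Arc ι F)) : ℂ :=
  if ∃ c ∈ mu, (a.left = c.left ∧ c.right < a.right) ∨ (a.left < c.left ∧ c.right = a.right) then 0
  else
    (Nat.card F : ℂ) ^ (Finset.univ.filter fun j : ι => a.left < j ∧ j < a.right).card /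
      (Nat.card F : ℂ) ^ (mu.filter fun c => a.left < c.left ∧ c.right < a.right).card *
      θ (a.label * wt mu a.left a.right)

/-- The character of a single arc, as a function on the unitriangular group. -/
def arcCharacter (θ : AddChar F ℂ) (a : Arc ι F) (u : U ι F) : ℂ :=
  arcValue θ a (superclassIndex u)

/-- The supercharacter `χ^lam`: the product of the characters of the arcs of `lam`. -/
def supercharacter (θ : AddChar F ℂ) (lam : Finset (Arc ι F)) (u : U ι F) : ℂ :=
  ∏ a ∈ lam, arcCharacter θ a u

/-- The usual inner product of complex functions on a finite group. -/
def innerProd {G : Type*} [Finite G] (φ ψ : G → ℂ) : ℂ :=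
  (Nat.card G : ℂ)⁻¹ * ∑ᶠ g : G, φ g * starRingEnd ℂ (ψ g)

/-- Restriction of a function on a group to a subgroup. -/
def res {G : Type*} [Group G] (H : Subgroup G) (φ : G → ℂ) : H → ℂ :=
  fun h => φ h

end Characters

section Graph

variable {ι F : Type*} [LinearOrder ι] [Zero F]

/-- The arcs of `lam` with both ends in `K`. -/
def VBullet (K : Set ι) (lam : Finset (Arc ι F)) : Set (Arc ι F) :=
  {a | a ∈ lam ∧ a.left ∈ K ∧ a.right ∈ K}

/-- The arcs of `lam` with both ends outside `K`. -/
def VCirc (K : Set ι) (lam : Finset (Arc ι F)) : Set (Arc ι F) :=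
  {a | a ∈ lam ∧ a.left ∉ K ∧ a.right ∉ K}

/-- The bipartite graph `Γ_K(lam)`: an arc `j — k` with both ends in `K` is joined to an arc `i — l`
with both ends outside `K` if `i < j < k < l`; there are no other edges. -/
def Gamma (K : Set ι) (lam : Finset (Arc ι F)) :
    SimpleGraph (VBullet K lam ⊕ VCirc K lam) where
  Adj
    | .inl v, .inr w => w.1.left < v.1.left ∧ v.1.right < w.1.right
    | .inr w, .inl v => w.1.left < v.1.left ∧ v.1.right < w.1.right
    | _, _ => False
  symm := ⟨by rintro (v | v) (w | w) h <;> exact h⟩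
  loopless := ⟨by rintro (v | v) h <;> exact h⟩

/-- `Γ_K(lam)` has a complete matching from `V_•` to `V_∘`: a matching that covers every element
of `V_•`. -/
def HasCompleteMatching (K : Set ι) (lam : Finset (Arc ι F)) : Prop :=
  ∃ M : (Gamma K lam).Subgraph, M.IsMatching ∧ ∀ v : VBullet K lam, Sum.inl v ∈ M.verts

end Graph

end Supercharacter

end

/-! Write `q` for the size of the field. Up to the factor `q ^ |L|`, the character of an arc `i —a—
l` is the exponential sum of `θ (a * xᵀ (u - 1) y)` over all `x` with leading entry `1` at `i` and
all `y` with last nonzero entry `1` at `l`. Unitriangular matrices permute these vectors, so the sum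
is constant on superclasses and can be computed on an arc matrix (`arcSum_mul_mul`,
`arcSum_arcMatrix`).

Multiplying over `lam` makes the supercharacter a positive multiple of a sum of functions `θ (∑ f j
k * (u - 1) j k)`, where `f` is the sum of the rank-one matrices `label * x yᵀ` of the arcs. On
`U_K` the entries at positions `j < k` in `K` are free, so such a function averages to `1` if `f`
vanishes at those positions and to `0` otherwise. The inner product is thus a positive multiple of
the number of choices of vectors for which `f` vanishes there (`innerProd_res_ne_zero_iff`): nothing
can cancel, and only the existence of such a cancelling family matters.

A matching yields a family: an arc of `V_∘` has room inside it to carry a second entry in each of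
its vectors, which cancels the arc of `V_•` matched to it (`exists_isCancelling`). Conversely,
triangular elimination turns the vectors attached to ends in `K` into unit vectors. For a set `S` of
arcs in `V_•`, the neighbours of `S` must then produce a triangular matrix of size `|S|` with
nonzero diagonal. Each neighbour contributes rank at most one, so Hall's condition holds
(`IsCancelling.exists_injective`). -/

noncomputable section

namespace Supercharacter

/-! ### Matchings as injections -/

section Matching

variable {ι F : Type*} [LinearOrder ι] [Zero F]

/-- A complete matching of `Γ_K(lam)` is the same as an injection of `V_•` into `V_∘` along edges. -/
lemma hasCompleteMatching_iff (K : Set ι) (lam : Finset (Arc ι F)) :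
    HasCompleteMatching K lam ↔ ∃ f : VBullet K lam → VCirc K lam, Function.Injective f ∧
      ∀ v, (f v).1.left < v.1.left ∧ v.1.right < (f v).1.right := by
  constructor
  · rintro ⟨M, hM, hcov⟩
    have hex : ∀ v : VBullet K lam, ∃ w : VCirc K lam, M.Adj (Sum.inl v) (Sum.inr w) := by
      intro v
      obtain ⟨w, hw, -⟩ := hM (hcov v)
      rcases w with w | w
      · exact (M.adj_sub hw).elim
      · exact ⟨w, hw⟩
    choose f hf using hex
    refine ⟨f, fun v v' hvv => ?_, fun v => M.adj_sub (hf v)⟩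
    have h1 := (hf v).symm
    have h2 := (hf v').symm
    rw [← hvv] at h2
    exact Sum.inl_injective ((hM h1.fst_mem).unique h1 h2)
  · rintro ⟨f, hf, hadj⟩
    refine ⟨{ verts := Set.range Sum.inl ∪ Set.range (fun v => Sum.inr (f v))
              Adj := fun p r => ∃ v, (p = Sum.inl v ∧ r = Sum.inr (f v)) ∨
                (r = Sum.inl v ∧ p = Sum.inr (f v))
              adj_sub := ?_
              edge_vert := ?_
              symm := ⟨?_⟩ }, ?_, fun v => Or.inl ⟨v, rfl⟩⟩
    · rintro p r ⟨v, ⟨rfl, rfl⟩ | ⟨rfl, rfl⟩⟩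
      · exact hadj v
      · exact hadj v
    · rintro p r ⟨v, ⟨rfl, rfl⟩ | ⟨rfl, rfl⟩⟩
      · exact Or.inl ⟨v, rfl⟩
      · exact Or.inr ⟨v, rfl⟩
    · rintro p r ⟨v, h⟩
      exact ⟨v, h.symm⟩
    · rintro p (⟨v, rfl⟩ | ⟨v, rfl⟩)
      · refine ⟨Sum.inr (f v), ⟨v, Or.inl ⟨rfl, rfl⟩⟩, ?_⟩
        rintro r ⟨v', ⟨h, rfl⟩ | ⟨-, h⟩⟩
        · rw [Sum.inl_injective h]
        · cases h
      · refine ⟨Sum.inl v, ⟨v, Or.inr ⟨rfl, rfl⟩⟩, ?_⟩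
        rintro r ⟨v', ⟨h, rfl⟩ | ⟨rfl, h⟩⟩
        · cases h
        · rw [hf (Sum.inr_injective h)]

end Matching

/-! ### Rank bound and triangular elimination -/

section LinearAlgebra

variable {F : Type*} [Field F]

/-- A matrix that is triangular with nonzero diagonal entries, up to an injective relabelling of its
indices, does not factor through a smaller dimension. -/
lemma card_le_of_triangular_factorization {ι n m : Type*} [LinearOrder ι] [Fintype n] [Fintype m]
    (ρ : n → ι) (hρ : Function.Injective ρ) (B : Matrix n m F) (C : Matrix m n F)
    (hzero : ∀ v w, ρ v < ρ w → (B * C) v w = 0) (hdiag : ∀ v, (B * C) v v ≠ 0) :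
    Fintype.card n ≤ Fintype.card m := by
  classical
  -- In the order pulled back along `ρ` the product is lower triangular with nonzero diagonal, so it
  -- has full rank, while its rank is at most the inner dimension.
  let _ : LinearOrder n := LinearOrder.lift' ρ hρ
  have hdet : (B * C).det = ∏ v, (B * C) v v :=
    Matrix.det_of_isLowerTriangular _ fun v w h => hzero v w h
  have hunit : IsUnit (B * C) := by
    rw [Matrix.isUnit_iff_isUnit_det, hdet, isUnit_iff_ne_zero]
    exact Finset.prod_ne_zero_iff.2 fun v _ => hdiag v
  calc Fintype.card n = (B * C).rank := (Matrix.rank_of_isUnit _ hunit).symm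
    _ ≤ B.rank := Matrix.rank_mul_le_left _ _
    _ ≤ Fintype.card m := Matrix.rank_le_card_width _

/-- Vectors with leading entries `1` in distinct positions are carried to unit vectors by a lower
triangular matrix. -/
lemma exists_lowerTriangular_mulVec_eq_single {ι T : Type*} [Fintype ι] [LinearOrder ι]
    (l : T → ι) (hl : Function.Injective l) (x : T → ι → F) (hone : ∀ t, x t (l t) = 1)
    (hzero : ∀ t, ∀ j < l t, x t j = 0) :
    ∃ P : Matrix ι ι F, (∀ i j, i < j → P i j = 0) ∧ ∀ t, P.mulVec (x t) = Pi.single (l t) 1 := by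
  classical
  -- Column `l t` is `x t` and the remaining columns are unit vectors. This matrix is lower
  -- unitriangular and sends unit vectors to the `x t`, so its inverse is the required `P`.
  let X : Matrix ι ι F := fun i j =>
    if h : ∃ t, l t = j then x h.choose i else (Pi.single j 1 : ι → F) i
  have hX : ∀ t, X.mulVec (Pi.single (l t) 1) = x t := by
    intro t
    ext i
    have h : ∃ s, l s = l t := ⟨t, rfl⟩
    rw [Matrix.mulVec_single_one, Matrix.col_apply]
    refine (dif_pos h).trans ?_
    rw [hl h.choose_spec]
  have hlow : X.BlockTriangular OrderDual.toDual := by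
    intro i j hij
    have hij : i < j := hij
    by_cases h : ∃ t, l t = j
    · simp only [X, dif_pos h]
      exact hzero _ _ (by rwa [h.choose_spec])
    · simp only [X, dif_neg h]
      exact Pi.single_eq_of_ne hij.ne _
  have hdet : X.det = 1 := by
    rw [Matrix.det_of_isLowerTriangular _ hlow]
    refine Finset.prod_eq_one fun j _ => ?_
    by_cases h : ∃ t, l t = j
    · simp only [X, dif_pos h]
      exact (congrArg _ h.choose_spec.symm).trans (hone _)
    · simp [X, dif_neg h]
  have : Invertible X := Matrix.invertibleOfIsUnitDet X (by rw [hdet]; exact isUnit_one)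
  refine ⟨X⁻¹, fun i j hij => ?_, fun t => ?_⟩
  · exact Matrix.blockTriangular_inv_of_blockTriangular hlow hij
  · rw [← hX t, Matrix.mulVec_mulVec, Matrix.inv_mul_of_invertible, Matrix.one_mulVec]

end LinearAlgebra

/-! ### Cancelling families and Hall's condition -/

section Cancelling

variable {ι : Type*} [LinearOrder ι] {F : Type*} [Field F]

/-- For each arc `a` a vector `x a` with leading entry `1` at the left end and a vector `y a` with
last nonzero entry `1` at the right end, such that the weighted sum of the products `x a j * y a k`
vanishes at all positions `j < k` in `K`. -/
structure IsCancelling (K : Set ι) (lam : Finset (Arc ι F)) (x y : lam → ι → F) : Prop where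
  left_one : ∀ a, x a a.1.left = 1
  left_zero : ∀ a, ∀ j < a.1.left, x a j = 0
  right_one : ∀ a, y a a.1.right = 1
  right_zero : ∀ a k, a.1.right < k → y a k = 0
  sum_eq_zero : ∀ j k, j < k → j ∈ K → k ∈ K → ∑ a, a.1.label * x a j * y a k = 0

/-- An injection of `V_•` into `V_∘` along edges gives a cancelling family. -/
lemma exists_isCancelling {K : Set ι} {lam : Finset (Arc ι F)}
    (f : VBullet K lam → VCirc K lam) (hf : Function.Injective f)
    (hadj : ∀ v, (f v).1.left < v.1.left ∧ v.1.right < (f v).1.right) :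
    ∃ x y, IsCancelling K lam x y := by
  classical
  have : Fintype (VBullet K lam) := (lam.finite_toSet.subset fun a h => h.1).fintype
  -- An arc `a` matched to `v` receives extra entries at the ends of `v`. Their product, weighted by
  -- the label of `a`, is minus the label of `v`.
  let x : lam → ι → F := fun a => if h : ∃ v, (f v).1 = a.1 then
    Pi.single a.1.left 1 + Pi.single h.choose.1.left (-h.choose.1.label / a.1.label)
    else Pi.single a.1.left 1
  let y : lam → ι → F := fun a => if h : ∃ v, (f v).1 = a.1 then
    Pi.single a.1.right 1 + Pi.single h.choose.1.right 1 else Pi.single a.1.right 1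
  have hch : ∀ (a : lam) (h : ∃ v, (f v).1 = a.1),
      a.1.left < h.choose.1.left ∧ h.choose.1.right < a.1.right := by
    intro a h
    have := hadj h.choose
    rwa [h.choose_spec] at this
  refine ⟨x, y, fun a => ?_, fun a j hj => ?_, fun a => ?_, fun a k hk => ?_,
    fun j k hjk hj hk => ?_⟩
  · by_cases h : ∃ v, (f v).1 = a.1
    · simp only [x, dif_pos h, Pi.add_apply, Pi.single_eq_same]
      rw [Pi.single_eq_of_ne (hch a h).1.ne, add_zero]
    · simp only [x, dif_neg h, Pi.single_eq_same]
  · by_cases h : ∃ v, (f v).1 = a.1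
    · simp only [x, dif_pos h, Pi.add_apply]
      rw [Pi.single_eq_of_ne hj.ne, Pi.single_eq_of_ne (hj.trans (hch a h).1).ne, add_zero]
    · simp only [x, dif_neg h]
      rw [Pi.single_eq_of_ne hj.ne]
  · by_cases h : ∃ v, (f v).1 = a.1
    · simp only [y, dif_pos h, Pi.add_apply, Pi.single_eq_same]
      rw [Pi.single_eq_of_ne (hch a h).2.ne', add_zero]
    · simp only [y, dif_neg h, Pi.single_eq_same]
  · by_cases h : ∃ v, (f v).1 = a.1
    · simp only [y, dif_pos h, Pi.add_apply]
      rw [Pi.single_eq_of_ne hk.ne', Pi.single_eq_of_ne ((hch a h).2.trans hk).ne', add_zero]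
    · simp only [y, dif_neg h]
      rw [Pi.single_eq_of_ne hk.ne']
  -- The ends of a matched `a` lie outside `K`, so at a position in `K` only the product of the two
  -- extra entries survives.
  · have hterm : ∀ a : lam, a.1.label * x a j * y a k =
        (if a.1.left = j ∧ a.1.right = k then a.1.label else 0) -
          ∑ v, if (f v).1 = a.1 then (if v.1.left = j ∧ v.1.right = k then v.1.label else 0)
            else 0 := by
      intro a
      by_cases h : ∃ v, (f v).1 = a.1
      · have hK := (f h.choose).2.2
        rw [h.choose_spec] at hK
        have hlj : a.1.left ≠ j := fun hh => hK.1 (hh ▸ hj)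
        have hrk : a.1.right ≠ k := fun hh => hK.2 (hh ▸ hk)
        rw [Finset.sum_eq_single h.choose, if_pos h.choose_spec]
        · simp only [x, y, dif_pos h, Pi.add_apply, Pi.single_apply, hlj.symm, hrk.symm, hlj,
            if_false, zero_add, false_and, zero_sub, eq_comm (a := j), eq_comm (a := k)]
          have := a.1.label_ne
          split_ifs <;> first | tauto | simp
          field_simp
        · intro v _ hv
          rw [if_neg]
          intro hh
          exact hv (hf (Subtype.ext (hh.trans h.choose_spec.symm)))
        · simp
      · rw [Finset.sum_eq_zero fun v _ => if_neg fun hh => h ⟨v, hh⟩]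
        simp only [x, y, dif_neg h, Pi.single_apply, eq_comm (a := j), eq_comm (a := k)]
        split_ifs <;> simp_all
    rw [Finset.sum_congr rfl fun a _ => hterm a, Finset.sum_sub_distrib, Finset.sum_comm,
      sub_eq_zero]
    have hv : ∀ v : VBullet K lam, (∑ a : lam, if (f v).1 = a.1 then
        (if v.1.left = j ∧ v.1.right = k then v.1.label else 0) else 0) =
          if v.1.left = j ∧ v.1.right = k then v.1.label else 0 := by
      intro v
      rw [Finset.sum_eq_single ⟨(f v).1, (f v).2.1⟩]
      · simp
      · intro a _ ha
        rw [if_neg]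
        intro hh
        exact ha (Subtype.ext hh.symm)
      · simp
    rw [Finset.sum_congr rfl fun v _ => hv v]
    symm
    -- An arc of `lam` from `j` to `k` has both ends in `K`, so only `V_•` contributes to the sum
    -- over `lam`.
    refine Finset.sum_of_injOn (fun v : VBullet K lam => (⟨v.1, v.2.1⟩ : lam)) ?_ ?_ ?_ ?_
    · intro v _ v' _ h
      exact Subtype.ext (congrArg (fun a : lam => a.1) h)
    · simp
    · intro a _ ha
      rw [if_neg]
      rintro ⟨rfl, rfl⟩
      exact ha ⟨⟨a.1, a.2, hj, hk⟩, by simp, rfl⟩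
    · intro v _
      rfl

variable [Fintype ι]

/-- Vanishing of a weighted sum of products above the diagonal persists after
multiplication by triangular matrices. -/
lemma sum_triangular_mulVec_eq_zero {T : Type*} [Fintype T] (c : T → F) (x y : T → ι → F)
    (P Q : Matrix ι ι F) (hP : ∀ i j, i < j → P i j = 0) (hQ : ∀ i j, j < i → Q i j = 0)
    (h : ∀ j k, j < k → ∑ a, c a * x a j * y a k = 0) {j k : ι} (hjk : j < k) :
    ∑ a, c a * (P.mulVec (x a)) j * (Q.mulVec (y a)) k = 0 := by
  have hexp : ∀ a, c a * (P.mulVec (x a)) j * (Q.mulVec (y a)) k =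
      ∑ r, ∑ s, P j r * Q k s * (c a * x a r * y a s) := by
    intro a
    simp only [Matrix.mulVec, dotProduct]
    rw [mul_assoc, Finset.sum_mul_sum, Finset.mul_sum]
    refine Finset.sum_congr rfl fun r _ => ?_
    rw [Finset.mul_sum]
    exact Finset.sum_congr rfl fun s _ => by ring
  rw [Finset.sum_congr rfl fun a _ => hexp a, Finset.sum_comm]
  refine Finset.sum_eq_zero fun r _ => ?_
  rw [Finset.sum_comm]
  refine Finset.sum_eq_zero fun s _ => ?_
  rw [← Finset.mul_sum]
  by_cases hr : j < r
  · rw [hP _ _ hr]; simp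
  by_cases hs : s < k
  · rw [hQ _ _ hs]; simp
  -- Only pairs with `r ≤ j < k ≤ s` survive, and these are again above the diagonal.
  rw [h r s ((not_lt.1 hr).trans_lt (hjk.trans_le (not_lt.1 hs))), mul_zero]

/-- A cancelling family forces Hall's condition, hence an injection of `V_•` into `V_∘` along
edges. -/
lemma IsCancelling.exists_injective {K : Set ι} {lam : Finset (Arc ι F)}
    (hlam : IsQSetPartition lam) {x y : lam → ι → F} (h : IsCancelling K lam x y) :
    ∃ f : VBullet K lam → VCirc K lam, Function.Injective f ∧
      ∀ v, (f v).1.left < v.1.left ∧ v.1.right < (f v).1.right := by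
  classical
  have hleft : ∀ a b : lam, a.1.left = b.1.left → a = b := by
    intro a b hab
    by_contra hne
    exact (hlam a.1 a.2 b.1 b.2 fun hh => hne (Subtype.ext hh)).1 hab
  have hright : ∀ a b : lam, a.1.right = b.1.right → a = b := by
    intro a b hab
    by_contra hne
    exact (hlam a.1 a.2 b.1 b.2 fun hh => hne (Subtype.ext hh)).2 hab
  -- Cutting the vectors off outside `K` makes the sum vanish at every position above the diagonal,
  -- as the triangular transformations require.
  let x₀ : lam → ι → F := fun a => K.indicator (x a)
  let y₀ : lam → ι → F := fun a => K.indicator (y a)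
  have hsum₀ : ∀ j k, j < k → ∑ a : lam, a.1.label * x₀ a j * y₀ a k = 0 := by
    intro j k hjk
    by_cases hj : j ∈ K
    · by_cases hk : k ∈ K
      · simpa [x₀, y₀, hj, hk] using h.sum_eq_zero j k hjk hj hk
      · simp [y₀, hk]
    · simp [x₀, hj]
  have hx₀ : ∀ a, ∀ j < a.1.left, x₀ a j = 0 := fun a j hj => by
    simp [x₀, Set.indicator_apply, h.left_zero a j hj]
  have hy₀ : ∀ a k, a.1.right < k → y₀ a k = 0 := fun a k hk => by
    simp [y₀, Set.indicator_apply, h.right_zero a k hk]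
  obtain ⟨P, hP, hPx⟩ := exists_lowerTriangular_mulVec_eq_single (ι := ι)
    (T := {a : lam // a.1.left ∈ K}) (fun a => a.1.1.left)
    (fun a b hab => Subtype.ext (hleft _ _ hab)) (fun a => x₀ a.1)
    (fun a => by simp [x₀, a.2, h.left_one]) (fun a => hx₀ a.1)
  -- In the dual order, last nonzero entries become leading entries and lower triangular becomes
  -- upper triangular.
  obtain ⟨Q, hQ, hQy⟩ := exists_lowerTriangular_mulVec_eq_single (ι := ιᵒᵈ)
    (T := {a : lam // a.1.right ∈ K}) (fun a => OrderDual.toDual a.1.1.right)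
    (fun a b hab => Subtype.ext (hright _ _ hab)) (fun a => y₀ a.1)
    (fun a => by
      change y₀ a.1 a.1.1.right = 1
      simp [y₀, a.2, h.right_one]) (fun a => hy₀ a.1)
  let Q' : Matrix ι ι F := Q
  have hQ' : ∀ i j, j < i → Q' i j = 0 := fun i j hij => hQ i j hij
  have hQy' : ∀ a : lam, a.1.right ∈ K → Q'.mulVec (y₀ a) = Pi.single a.1.right 1 :=
    fun a ha => hQy ⟨a, ha⟩
  have hPx' : ∀ a : lam, a.1.left ∈ K → P.mulVec (x₀ a) = Pi.single a.1.left 1 :=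
    fun a ha => hPx ⟨a, ha⟩
  let x₁ : lam → ι → F := fun a => P.mulVec (x₀ a)
  let y₁ : lam → ι → F := fun a => Q'.mulVec (y₀ a)
  have hsum₁ : ∀ j k, j < k → ∑ a : lam, a.1.label * x₁ a j * y₁ a k = 0 := fun j k hjk =>
    sum_triangular_mulVec_eq_zero (fun a : lam => a.1.label) x₀ y₀ P Q' hP hQ' hsum₀ hjk
  -- The inequality is strict because the cut-off removed the leading entry at a left end outside
  -- `K`; `P` only moves entries to larger indices.
  have hx₁ : ∀ a : lam, a.1.left ∉ K → ∀ j, x₁ a j ≠ 0 → a.1.left < j := by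
    intro a ha j hj
    obtain ⟨r, -, hr⟩ := Finset.exists_ne_zero_of_sum_ne_zero hj
    have h1 : r ≤ j := not_lt.1 fun hh => left_ne_zero_of_mul hr (hP _ _ hh)
    have h2 : a.1.left ≤ r := not_lt.1 fun hh => right_ne_zero_of_mul hr (hx₀ _ _ hh)
    have h3 : a.1.left ≠ r := fun hh =>
      right_ne_zero_of_mul hr (by simp [x₀, ← hh, ha])
    exact (h2.lt_of_ne h3).trans_le h1
  have hy₁ : ∀ a : lam, a.1.right ∉ K → ∀ k, y₁ a k ≠ 0 → k < a.1.right := by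
    intro a ha k hk
    obtain ⟨r, -, hr⟩ := Finset.exists_ne_zero_of_sum_ne_zero hk
    have h1 : k ≤ r := not_lt.1 fun hh => left_ne_zero_of_mul hr (hQ' _ _ hh)
    have h2 : r ≤ a.1.right := not_lt.1 fun hh => right_ne_zero_of_mul hr (hy₀ _ _ hh)
    have h3 : a.1.right ≠ r := fun hh =>
      right_ne_zero_of_mul hr (by simp [y₀, ← hh, ha])
    exact h1.trans_lt (h2.lt_of_ne h3.symm)
  let E : VBullet K lam → lam → Prop := fun v a =>
    (a.1.left ∉ K ∧ a.1.right ∉ K) ∧ a.1.left < v.1.left ∧ v.1.right < a.1.right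
  have hall : ∀ S : Finset (VBullet K lam),
      S.card ≤ (Finset.univ.filter fun a => ∃ v ∈ S, E v a).card := by
    intro S
    set N := Finset.univ.filter fun a => ∃ v ∈ S, E v a with hN
    let B : Matrix S N F := fun v a => a.1.1.label * x₁ a.1 v.1.1.left
    let C : Matrix N S F := fun a v => y₁ a.1 v.1.1.right
    -- The position `(v.left, w.right)` is above the diagonal, so the full sum vanishes there.
    -- Outside `N` only `v` itself can contribute, and only for `v = w`; hence the part from `N` is
    -- minus that contribution.
    have hBC : ∀ v w : S, v.1.1.left ≤ w.1.1.left →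
        (B * C) v w = if v = w then -v.1.1.label else 0 := by
      intro v w hvw
      have hz := hsum₁ v.1.1.left w.1.1.right (hvw.trans_lt w.1.1.lt)
      let v₀ : lam := ⟨v.1.1, v.1.2.1⟩
      have hterm : ∀ a : lam, a ∉ N → a.1.label * x₁ a v.1.1.left * y₁ a w.1.1.right =
          if a = v₀ then (if v = w then v.1.1.label else 0) else 0 := by
        intro a ha
        by_cases hl : a.1.left ∈ K
        · simp only [x₁, hPx' a hl]
          by_cases hav : a = v₀
          · subst hav
            have hr : (v₀.1.right) ∈ K := v.1.2.2.2
            simp only [y₁, hQy' v₀ hr, if_true]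
            by_cases hvw' : v = w
            · subst hvw'
              simp [v₀]
            · have : w.1.1.right ≠ v₀.1.right := fun hh => hvw' (Subtype.ext (Subtype.ext
                (congrArg (fun a : lam => a.1)
                  (hright ⟨w.1.1, w.1.2.1⟩ v₀ hh)).symm))
              simp [Pi.single_eq_of_ne this, hvw']
          · have : v.1.1.left ≠ a.1.left := fun hh => hav (hleft a v₀ hh.symm)
            simp [Pi.single_eq_of_ne this, hav]
        · have hav : a ≠ v₀ := fun hh => hl (hh ▸ v.1.2.2.1)
          rw [if_neg hav]
          by_cases hr : a.1.right ∈ K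
          -- Equal right ends would force `a` to be `w`, whose left end is in `K`.
          · have : w.1.1.right ≠ a.1.right := fun hh => hl (by
              rw [hright a ⟨w.1.1, w.1.2.1⟩ hh.symm]
              exact w.1.2.2.1)
            simp only [y₁, hQy' a hr, Pi.single_eq_of_ne this, mul_zero]
          -- With both ends of `a` outside `K`, a nonzero term makes `a` strictly enclose `w`, which
          -- puts `a` in `N`.
          · by_contra hne
            refine ha (Finset.mem_filter.2 ⟨Finset.mem_univ _, w.1, w.2, ⟨hl, hr⟩, ?_, ?_⟩)
            · exact (hx₁ a hl _ (right_ne_zero_of_mul (left_ne_zero_of_mul hne))).trans_le hvw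
            · exact hy₁ a hr _ (right_ne_zero_of_mul hne)
      have hv₀ : v₀ ∉ N := by
        simp only [hN, Finset.mem_filter, not_and, E]
        rintro - ⟨_, _, hh, _⟩
        exact hh.1 v.1.2.2.1
      rw [← Finset.sum_add_sum_compl N, ← Finset.sum_coe_sort N,
        Finset.sum_congr rfl fun a ha => hterm a (Finset.mem_compl.1 ha),
        Finset.sum_ite_eq' , if_pos (Finset.mem_compl.2 hv₀)] at hz
      rw [Matrix.mul_apply]
      refine (eq_neg_of_add_eq_zero_left hz).trans ?_
      split_ifs <;> simp
    have := card_le_of_triangular_factorization (fun v : S => v.1.1.left)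
      (fun v w hvw => Subtype.ext (Subtype.ext (congrArg (fun a : lam => a.1)
        (hleft ⟨v.1.1, v.1.2.1⟩ ⟨w.1.1, w.1.2.1⟩ hvw)))) B C
      (fun v w hvw => by
        rw [hBC v w hvw.le, if_neg]
        rintro rfl
        exact hvw.ne rfl)
      (fun v => by
        rw [hBC v v le_rfl, if_pos rfl]
        exact neg_ne_zero.2 v.1.1.label_ne)
    simpa using this
  obtain ⟨f, hf, hE⟩ := (Fintype.all_card_le_filter_rel_iff_exists_injective E).1 hall
  exact ⟨fun v => ⟨(f v).1, (f v).2, (hE v).1⟩,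
    fun v w hvw => hf (Subtype.ext (congrArg (fun a : VCirc K lam => a.1) hvw)),
    fun v => (hE v).2⟩

end Cancelling

/-! ### Arc matrices acting on vectors -/

section ArcMatrix

variable {ι : Type*} [Fintype ι] [LinearOrder ι] {F : Type*} [Field F]

lemma vecMul_arcMatrix_right {mu : Finset (Arc ι F)} (hmu : IsQSetPartition mu) (x : ι → F)
    {b : Arc ι F} (hb : b ∈ mu) :
    Matrix.vecMul x (arcMatrix mu) b.right = x b.left * b.label := by
  rw [Matrix.vecMul, dotProduct, Finset.sum_eq_single b.left, arcMatrix_of_mem hmu hb]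
  · intro j _ hj
    by_contra hne
    obtain ⟨d, hd, hl, hr, -⟩ := exists_mem_of_arcMatrix_ne hmu (right_ne_zero_of_mul hne)
    by_cases hdb : d = b
    · exact hj (by rw [← hl, hdb])
    · exact (hmu d hd b hb hdb).2 hr
  · simp

lemma forall_vecMul_arcMatrix_eq_zero_iff {mu : Finset (Arc ι F)} (hmu : IsQSetPartition mu)
    (x : ι → F) (R : ι) :
    (∀ k < R, Matrix.vecMul x (arcMatrix mu) k = 0) ↔
      ∀ b ∈ mu, b.right < R → x b.left = 0 := by
  constructor
  · intro h b hb hbR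
    have := h _ hbR
    rw [vecMul_arcMatrix_right hmu x hb] at this
    exact (mul_eq_zero.1 this).resolve_right b.label_ne
  · intro h k hk
    refine Finset.sum_eq_zero fun j _ => ?_
    by_cases hN : arcMatrix mu j k = 0
    · exact mul_eq_zero_of_right _ hN
    · obtain ⟨b, hb, rfl, rfl, -⟩ := exists_mem_of_arcMatrix_ne hmu hN
      rw [h b hb hk, zero_mul]

lemma wt_eq_arcMatrix (mu : Finset (Arc ι F)) (i l : ι) : wt mu i l = arcMatrix mu i l := by
  classical
  rw [arcMatrix_apply, wt, Finset.sum_filter]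

end ArcMatrix

/-! ### Arc characters as exponential sums -/

section ArcSum

variable {ι : Type*} [Fintype ι] [LinearOrder ι] {F : Type*} [Field F] [Fintype F]

lemma map_sum_eq_prod {A M κ : Type*} [AddCommMonoid A] [CommMonoid M] (ψ : AddChar A M)
    (s : Finset κ) (f : κ → A) : ψ (∑ i ∈ s, f i) = ∏ i ∈ s, ψ (f i) := by
  classical
  induction s using Finset.induction_on with
  | empty => simp
  | insert i s hi ih => rw [Finset.sum_insert hi, Finset.prod_insert hi, ψ.map_add_eq_mul, ih]

lemma sum_apply_mul [DecidableEq F] {θ : AddChar F ℂ} (hθ : θ ≠ 1) (c : F) :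
    ∑ t, θ (t * c) = if c = 0 then (Fintype.card F : ℂ) else 0 := by
  rw [AddChar.sum_mulShift c (AddChar.IsPrimitive.of_ne_one hθ), Nat.cast_ite, Nat.cast_zero]

open Classical in
/-- The vectors with entry `1` at `i` and entry `0` at all other positions that satisfy `r`. -/
def pinned (F : Type*) [Field F] [Fintype F] (r : ι → Prop) (i : ι) : Finset (ι → F) :=
  Fintype.piFinset fun j => if j = i then {1} else if r j then {0} else Finset.univ

lemma mem_pinned {r : ι → Prop} {i : ι} {x : ι → F} :
    x ∈ pinned F r i ↔ x i = 1 ∧ ∀ j, j ≠ i → r j → x j = 0 := by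
  classical
  rw [pinned, Fintype.mem_piFinset]
  constructor
  · intro h
    refine ⟨by simpa using h i, fun j hj hr => by simpa [hj, hr] using h j⟩
  · rintro ⟨h1, h0⟩ j
    by_cases hj : j = i
    · subst hj; simp [h1]
    · by_cases hr : r j
      · simp [hj, hr, h0 j hj hr]
      · simp [hj, hr]

lemma mem_pinned_lt {i : ι} {x : ι → F} :
    x ∈ pinned F (· < i) i ↔ x i = 1 ∧ ∀ j < i, x j = 0 :=
  mem_pinned.trans ⟨fun h => ⟨h.1, fun j hj => h.2 j hj.ne hj⟩,
    fun h => ⟨h.1, fun j _ hj => h.2 j hj⟩⟩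

lemma mem_pinned_gt {i : ι} {x : ι → F} :
    x ∈ pinned F (i < ·) i ↔ x i = 1 ∧ ∀ j, i < j → x j = 0 :=
  mem_pinned.trans ⟨fun h => ⟨h.1, fun j hj => h.2 j hj.ne' hj⟩,
    fun h => ⟨h.1, fun j _ hj => h.2 j hj⟩⟩

/-- The free coordinates separate, and a coordinate pinned to `0` contributes the factor `h j 0 =
1`. -/
lemma sum_pinned_prod (r : ι → Prop) (i : ι) (s : Finset ι) (hs : ∀ j, j ∈ s ↔ j ≠ i ∧ ¬ r j)
    (h : ι → F → ℂ) (h0 : ∀ j, h j 0 = 1) :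
    ∑ x ∈ pinned F r i, ∏ j, h j (x j) = h i 1 * ∏ j ∈ s, ∑ t, h j t := by
  classical
  rw [pinned, ← Finset.prod_univ_sum, ← Finset.mul_prod_erase _ _ (Finset.mem_univ i), if_pos rfl,
    Finset.sum_singleton]
  congr 1
  symm
  refine Finset.prod_subset_one_on_sdiff (fun j hj => ?_) (fun j hj => ?_) (fun j hj => ?_)
  · simp [((hs j).1 hj).1]
  · simp only [Finset.mem_sdiff, Finset.mem_erase, hs, Finset.mem_univ,
      and_true, not_and, not_not] at hj
    simp [hj.1, hj.2 hj.1, h0]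
  · simp [((hs j).1 hj).1, ((hs j).1 hj).2]

lemma vecMul_mem_pinned (g : U ι F) {i : ι} {x : ι → F} (hx : x ∈ pinned F (· < i) i) :
    Matrix.vecMul x (toMat g) ∈ pinned F (· < i) i := by
  rw [mem_pinned_lt] at hx ⊢
  constructor
  · rw [Matrix.vecMul, dotProduct, Finset.sum_eq_single i, hx.1, toMat_diag, one_mul]
    · intro j _ hj
      rcases lt_or_gt_of_ne hj with h | h
      · rw [hx.2 j h, zero_mul]
      · rw [toMat_below g h, mul_zero]
    · simp
  · intro k hk
    rw [Matrix.vecMul, dotProduct]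
    refine Finset.sum_eq_zero fun j _ => ?_
    rcases lt_or_ge j i with h | h
    · rw [hx.2 j h, zero_mul]
    · rw [toMat_below g (hk.trans_le h), mul_zero]

lemma mulVec_mem_pinned (g : U ι F) {i : ι} {y : ι → F} (hy : y ∈ pinned F (i < ·) i) :
    Matrix.mulVec (toMat g) y ∈ pinned F (i < ·) i := by
  rw [mem_pinned_gt] at hy ⊢
  constructor
  · rw [Matrix.mulVec, dotProduct, Finset.sum_eq_single i, hy.1, toMat_diag, one_mul]
    · intro j _ hj
      rcases lt_or_gt_of_ne hj with h | h
      · rw [toMat_below g h, zero_mul]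
      · rw [hy.2 j h, mul_zero]
    · simp
  · intro k hk
    rw [Matrix.mulVec, dotProduct]
    refine Finset.sum_eq_zero fun j _ => ?_
    rcases lt_or_ge i j with h | h
    · rw [hy.2 j h, mul_zero]
    · rw [toMat_below g (h.trans_lt hk), zero_mul]

/-- The sum of `θ (c * xᵀ M y)` over the vectors `x` with leading entry `1` at the left end of the
arc and the vectors `y` with last nonzero entry `1` at its right end, where `c` is its label. -/
def arcSum (θ : AddChar F ℂ) (a : Arc ι F) (M : Matrix ι ι F) : ℂ :=
  ∑ x ∈ pinned F (· < a.left) a.left, ∑ y ∈ pinned F (a.right < ·) a.right,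
    θ (a.label * (x ⬝ᵥ M.mulVec y))

/-- Reindexing by `x ↦ x g` and `y ↦ h y` permutes the two ranges of summation, because
unitriangular matrices preserve leading and last entries equal to `1`. -/
lemma arcSum_mul_mul (θ : AddChar F ℂ) (a : Arc ι F) (M : Matrix ι ι F) (g h : U ι F) :
    arcSum θ a (toMat g * M * toMat h) = arcSum θ a M := by
  have hc : ∀ z : U ι F, toMat z⁻¹ * toMat z = 1 := fun z => by
    rw [← toMat_mul, inv_mul_cancel, toMat_one]
  have hc' : ∀ z : U ι F, toMat z * toMat z⁻¹ = 1 := fun z => by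
    rw [← toMat_mul, mul_inv_cancel, toMat_one]
  unfold arcSum
  refine Finset.sum_nbij' (fun x => Matrix.vecMul x (toMat g))
    (fun x => Matrix.vecMul x (toMat g⁻¹))
    (fun x hx => vecMul_mem_pinned g hx) (fun x hx => vecMul_mem_pinned g⁻¹ hx)
    (fun x _ => by rw [Matrix.vecMul_vecMul, hc', Matrix.vecMul_one])
    (fun x _ => by rw [Matrix.vecMul_vecMul, hc, Matrix.vecMul_one]) fun x _ => ?_
  refine Finset.sum_nbij' (fun y => (toMat h).mulVec y) (fun y => (toMat h⁻¹).mulVec y)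
    (fun y hy => mulVec_mem_pinned h hy) (fun y hy => mulVec_mem_pinned h⁻¹ hy)
    (fun y _ => by rw [Matrix.mulVec_mulVec, hc, Matrix.one_mulVec])
    (fun y _ => by rw [Matrix.mulVec_mulVec, hc', Matrix.one_mulVec]) fun y _ => ?_
  rw [← Matrix.mulVec_mulVec, ← Matrix.mulVec_mulVec, Matrix.dotProduct_mulVec]

-- Each free coordinate `k < R` of `y` gives a complete character sum, which vanishes unless `z k =
-- 0`; the pinned entry at `R` leaves `θ (c * z R)`.
open Classical in
lemma sum_pinned_gt {θ : AddChar F ℂ} (hθ : θ ≠ 1) {c : F} (hc : c ≠ 0) (R : ι) (z : ι → F) :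
    ∑ y ∈ pinned F (R < ·) R, θ (c * (z ⬝ᵥ y)) =
      if ∀ k < R, z k = 0 then
        (Fintype.card F : ℂ) ^ (Finset.univ.filter fun k : ι => k < R).card * θ (c * z R) else 0 := by
  have hprod : ∀ y : ι → F, θ (c * (z ⬝ᵥ y)) = ∏ k, θ (y k * (c * z k)) := by
    intro y
    rw [← map_sum_eq_prod, dotProduct, Finset.mul_sum]
    exact congrArg θ (Finset.sum_congr rfl fun k _ => by ring)
  rw [Finset.sum_congr rfl fun y _ => hprod y,
    sum_pinned_prod (R < ·) R (Finset.univ.filter fun k : ι => k < R)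
      (fun k => by rw [Finset.mem_filter_univ, not_lt, lt_iff_le_and_ne, and_comm])
      (fun k t => θ (t * (c * z k)))
      (fun k => by simp), one_mul, Finset.prod_congr rfl fun k _ => sum_apply_mul hθ (c * z k)]
  split_ifs with h
  · rw [Finset.prod_congr rfl fun k hk => if_pos (by
      rw [h k (Finset.mem_filter.1 hk).2, mul_zero]), Finset.prod_const, mul_comm]
  · push Not at h
    obtain ⟨k, hk, hzk⟩ := h
    rw [Finset.prod_eq_zero (i := k) (by simpa using hk), mul_zero]
    rw [if_neg (mul_ne_zero hc hzk)]

/-- Exponent bookkeeping for `arcSum_arcMatrix`: since `L < R`, the indices above `L` are those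
strictly between `L` and `R` together with those not below `R`. -/
lemma card_filter_lt_add (L R : ι) (hLR : L < R) (J : Finset ι) :
    (Finset.univ.filter fun k : ι => k < R).card +
        (Finset.univ.filter fun j : ι => L < j ∧ j ∉ J).card +
          (Finset.univ.filter fun j : ι => L < j ∧ j ∈ J).card =
      Fintype.card ι + (Finset.univ.filter fun j : ι => L < j ∧ j < R).card := by
  have h1 := Finset.card_filter_add_card_filter_not (s := (Finset.univ : Finset ι)) (· < R)
  have h2 := Finset.card_filter_add_card_filter_not
    (s := (Finset.univ.filter fun j : ι => L < j)) (· < R)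
  have h3 := Finset.card_filter_add_card_filter_not
    (s := (Finset.univ.filter fun j : ι => L < j)) (· ∈ J)
  have h4 : ((Finset.univ.filter fun j : ι => L < j).filter fun j => ¬ j < R) =
      Finset.univ.filter fun j : ι => ¬ j < R := by
    ext j
    simp only [Finset.mem_filter, Finset.mem_univ, true_and, not_lt]
    exact ⟨fun h => h.2, fun h => ⟨hLR.trans_le h, h⟩⟩
  rw [h4] at h2
  rw [Finset.filter_filter] at h2 h3
  rw [Finset.filter_filter] at h3
  rw [Finset.card_univ] at h1
  omega

/-- On a superclass, the sum of an arc is a constant multiple of the character of the arc. -/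
lemma arcSum_arcMatrix {θ : AddChar F ℂ} (hθ : θ ≠ 1) (a : Arc ι F) {mu : Finset (Arc ι F)}
    (hmu : IsQSetPartition mu) :
    arcSum θ a (arcMatrix mu) = (Fintype.card F : ℂ) ^ Fintype.card ι * arcValue θ a mu := by
  classical
  set L := a.left with hL
  set R := a.right with hR
  set N := arcMatrix mu with hN
  -- The sum over `y` forces `x` to vanish at the left ends of the arcs ending before `R`; these
  -- form `J`.
  set J : Finset ι := (mu.filter fun b => b.right < R).image Arc.left with hJ
  have hmemJ : ∀ j, j ∈ J ↔ ∃ b ∈ mu, b.right < R ∧ b.left = j := by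
    intro j
    simp only [hJ, Finset.mem_image, Finset.mem_filter]
    tauto
  -- Building the constraint on `J` into the factors makes the sum over `x` separate into
  -- coordinates.
  let h : ι → F → ℂ := fun j t => if j ∈ J ∧ t ≠ 0 then 0 else θ (t * (a.label * N j R))
  have hx : ∀ x : ι → F, (∑ y ∈ pinned F (R < ·) R, θ (a.label * (x ⬝ᵥ N.mulVec y))) =
      (Fintype.card F : ℂ) ^ (Finset.univ.filter fun k : ι => k < R).card * ∏ j, h j (x j) := by
    intro x
    simp only [Matrix.dotProduct_mulVec]
    rw [sum_pinned_gt hθ a.label_ne, if_congr (forall_vecMul_arcMatrix_eq_zero_iff hmu x R) rfl rfl]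
    split_ifs with hc
    · congr 1
      have hj : ∀ j, h j (x j) = θ (x j * (a.label * N j R)) := by
        intro j
        refine if_neg ?_
        rintro ⟨hj, hne⟩
        obtain ⟨b, hb, hbR, rfl⟩ := (hmemJ j).1 hj
        exact hne (hc b hb hbR)
      rw [Finset.prod_congr rfl fun j _ => hj j, ← map_sum_eq_prod, Matrix.vecMul,
        dotProduct, Finset.mul_sum]
      exact congrArg θ (Finset.sum_congr rfl fun j _ => by ring)
    · push Not at hc
      obtain ⟨b, hb, hbR, hne⟩ := hc
      rw [Finset.prod_eq_zero (Finset.mem_univ b.left), mul_zero]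
      exact if_pos ⟨(hmemJ _).2 ⟨b, hb, hbR, rfl⟩, hne⟩
  have hsum : ∀ j, ∑ t, h j t =
      if j ∈ J then 1 else if N j R = 0 then (Fintype.card F : ℂ) else 0 := by
    intro j
    by_cases hj : j ∈ J
    · rw [if_pos hj, Finset.sum_eq_single 0]
      · simp [h]
      · intro t _ ht
        exact if_pos ⟨hj, ht⟩
      · simp
    · have : ∀ t, h j t = θ (t * (a.label * N j R)) := fun t => if_neg fun hh => hj hh.1
      rw [if_neg hj, Finset.sum_congr rfl fun t _ => this t,
        sum_apply_mul hθ]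
      simp [a.label_ne]
  have hleft : ∀ b ∈ mu, ∀ d ∈ mu, b.left = d.left → b = d := by
    intro b hb d hd hbd
    by_contra hne
    exact (hmu b hb d hd hne).1 hbd
  have hS : arcSum θ a N = (Fintype.card F : ℂ) ^ (Finset.univ.filter fun k : ι => k < R).card *
      (h L 1 * ∏ j with L < j,
        if j ∈ J then 1 else if N j R = 0 then (Fintype.card F : ℂ) else 0) := by
    rw [arcSum, Finset.sum_congr rfl fun x _ => hx x, ← Finset.mul_sum,
      sum_pinned_prod (· < L) L (Finset.univ.filter fun k : ι => L < k)
        (fun k => by rw [Finset.mem_filter_univ, not_lt, lt_iff_le_and_ne, and_comm, ne_comm]) h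
        (fun j => by simp [h]),
      Finset.prod_congr rfl fun j _ => hsum j]
  rw [hS, arcValue]
  split_ifs with hbad
  · rw [mul_zero]
    -- In the first case `x` would have to vanish at `L`, where it is `1`. In the second the
    -- coordinate `b.left` is free and its character sum is nontrivial.
    obtain ⟨b, hb, ⟨h1, h2⟩ | ⟨h1, h2⟩⟩ := hbad
    · have : h L 1 = 0 := if_pos ⟨(hmemJ _).2 ⟨b, hb, h2, h1.symm⟩, one_ne_zero⟩
      rw [this, zero_mul, mul_zero]
    · rw [Finset.prod_eq_zero (i := b.left) (by simpa using h1), mul_zero, mul_zero]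
      have hbJ : b.left ∉ J := by
        rw [hmemJ]
        rintro ⟨d, hd, hdR, hdb⟩
        rw [hleft d hd b hb hdb] at hdR
        exact hdR.ne h2
      have hbN : N b.left R ≠ 0 := by
        rw [hN, hR, ← h2, arcMatrix_of_mem hmu hb]
        exact b.label_ne
      rw [if_neg hbJ, if_neg hbN]
  · push Not at hbad
    have hLJ : L ∉ J := by
      rw [hmemJ]
      rintro ⟨b, hb, hbR, hbL⟩
      exact absurd hbR (not_lt.2 ((hbad b hb).1 hbL.symm))
    have hNz : ∀ j, L < j → N j R = 0 := by
      intro j hj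
      by_contra hne
      obtain ⟨b, hb, rfl, hr, -⟩ := exists_mem_of_arcMatrix_ne hmu hne
      exact (hbad b hb).2 hj hr
    have h1 : h L 1 = θ (a.label * wt mu L R) := by
      rw [wt_eq_arcMatrix]
      simp only [h, hLJ, false_and, if_false, one_mul, hN]
    have h2 : (∏ j with L < j, if j ∈ J then 1 else if N j R = 0 then (Fintype.card F : ℂ) else 0) =
        (Fintype.card F : ℂ) ^ (Finset.univ.filter fun j : ι => L < j ∧ j ∉ J).card := by
      rw [Finset.prod_congr rfl fun j hj => if_congr Iff.rfl rfl
        (if_pos (hNz j (Finset.mem_filter.1 hj).2)), Finset.prod_ite, Finset.prod_const_one, one_mul,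
        Finset.prod_const, Finset.filter_filter]
    -- Left ends are distinct, so the arcs nested inside `a` correspond to the indices of `J` above
    -- `L`.
    have h3 : (mu.filter fun c => L < c.left ∧ c.right < R).card =
        (Finset.univ.filter fun j : ι => L < j ∧ j ∈ J).card := by
      refine Finset.card_nbij Arc.left (fun b hb => ?_) (fun b hb d hd hbd => ?_) (fun j hj => ?_)
      · simp only [Finset.coe_filter, Set.mem_ofPred_eq] at hb
        simpa [hmemJ, hb.2.1] using ⟨b, hb.1, hb.2.2, rfl⟩
      · simp only [Finset.coe_filter, Set.mem_ofPred_eq] at hb hd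
        exact hleft b hb.1 d hd.1 hbd
      · simp only [Finset.coe_filter, Set.mem_ofPred_eq, Finset.mem_univ, true_and, hmemJ] at hj
        obtain ⟨hj, b, hb, hbR, rfl⟩ := hj
        exact ⟨b, by simpa using ⟨hb, hj, hbR⟩, rfl⟩
    have hcard := card_filter_lt_add L R a.lt J
    have hq : (Fintype.card F : ℂ) ≠ 0 := Nat.cast_ne_zero.2 Fintype.card_ne_zero
    rw [h1, h2, h3, Nat.card_eq_fintype_card]
    have hpow := congrArg (fun n => (Fintype.card F : ℂ) ^ n) hcard
    simp only [pow_add] at hpow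
    field_simp
    linear_combination θ (a.label * wt mu L R) * hpow

lemma arcSum_toMat_sub_one {θ : AddChar F ℂ} (hθ : θ ≠ 1) (a : Arc ι F) (u : U ι F) :
    arcSum θ a (toMat u - 1) = (Fintype.card F : ℂ) ^ Fintype.card ι * arcCharacter θ a u := by
  obtain ⟨hmu, x, y, hxy⟩ := superclassIndex_spec u
  rw [hxy, arcSum_mul_mul, arcSum_arcMatrix hθ a hmu, arcCharacter]

end ArcSum

/-! ### Averaging over `U_K` -/

section Restriction

variable {ι : Type*} [Fintype ι] [LinearOrder ι] {F : Type*} [Field F]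

/-- The positions above the diagonal with both indices in `K`. -/
abbrev UpperPos (K : Set ι) : Type _ := {p : ι × ι // p.1 < p.2 ∧ p.1 ∈ K ∧ p.2 ∈ K}

/-- An element of `U_K` is determined by arbitrary entries at the positions above the diagonal with
both indices in `K`. -/
lemma bijective_entries (K : Set ι) :
    Function.Bijective fun (u : UK F K) (p : UpperPos K) => toMat u.1 p.1.1 p.1.2 := by
  classical
  constructor
  · intro u v huv
    refine Subtype.ext (Subtype.ext (Units.ext (Matrix.ext fun i j => ?_)))
    change toMat u.1 i j = toMat v.1 i j
    rcases lt_trichotomy i j with h | rfl | h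
    · by_cases hK : i ∈ K ∧ j ∈ K
      · exact congrFun huv ⟨(i, j), h, hK⟩
      · rw [u.2 i j h hK, v.2 i j h hK]
    · rw [toMat_diag, toMat_diag]
    · rw [toMat_below _ h, toMat_below _ h]
  · intro w
    let M : Matrix ι ι F := fun i j =>
      if h : i < j ∧ i ∈ K ∧ j ∈ K then w ⟨(i, j), h⟩ else if i = j then 1 else 0
    have hdiag : ∀ i, M i i = 1 := fun i => by simp [M]
    have hlow : ∀ i j, j < i → M i j = 0 := fun i j h => by simp [M, h.not_gt, h.ne']
    have hdet : M.det = 1 := by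
      rw [Matrix.det_of_isUpperTriangular (fun i j h => hlow i j h)]
      exact Finset.prod_eq_one fun i _ => hdiag i
    let g : GL ι F := Matrix.GeneralLinearGroup.mkOfDetNeZero M (by rw [hdet]; exact one_ne_zero)
    refine ⟨⟨⟨g, hdiag, hlow⟩, fun i j hij hK => ?_⟩, ?_⟩
    · change M i j = 0
      simp [M, hK, hij.ne]
    · ext p
      change M p.1.1 p.1.2 = w p
      simp [M, p.2.1, p.2.2.1, p.2.2.2]

-- The entries of `u` at the positions above the diagonal in `K` are independent and `u - 1`
-- vanishes elsewhere, so the sum is a product of complete character sums.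
open Classical in
lemma sum_UK_eq [Fintype F] {θ : AddChar F ℂ} (hθ : θ ≠ 1) (K : Set ι) [Fintype (UK F K)]
    (f : ι → ι → F) :
    ∑ u : UK F K, θ (∑ j, ∑ k, f j k * (toMat u.1 - 1) j k) =
      if ∀ j k, j < k → j ∈ K → k ∈ K → f j k = 0 then
        (Fintype.card F : ℂ) ^ Fintype.card (UpperPos K) else 0 := by
  have hterm : ∀ u : UK F K, θ (∑ j, ∑ k, f j k * (toMat u.1 - 1) j k) =
      ∏ p : UpperPos K, θ (toMat u.1 p.1.1 p.1.2 * f p.1.1 p.1.2) := by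
    intro u
    rw [← map_sum_eq_prod, ← Fintype.sum_prod_type' fun j k => f j k * (toMat u.1 - 1) j k]
    congr 1
    symm
    refine Finset.sum_of_injOn (fun p : UpperPos K => p.1) (Subtype.val_injective.injOn)
      (by simp) (fun p _ hp => ?_) (fun p _ => ?_)
    · have hp : ¬ (p.1 < p.2 ∧ p.1 ∈ K ∧ p.2 ∈ K) := fun hh => hp ⟨⟨p, hh⟩, by simp, rfl⟩
      rw [Matrix.sub_apply]
      rcases lt_trichotomy p.1 p.2 with h | h | h
      · rw [u.2 _ _ h (fun hh => hp ⟨h, hh⟩), Matrix.one_apply_ne h.ne, sub_zero, mul_zero]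
      · rw [← h, toMat_diag, Matrix.one_apply_eq, sub_self, mul_zero]
      · rw [toMat_below _ h, Matrix.one_apply_ne h.ne', sub_zero, mul_zero]
    · rw [Matrix.sub_apply, Matrix.one_apply_ne p.2.1.ne, sub_zero, mul_comm]
  rw [Finset.sum_congr rfl fun u _ => hterm u,
    Fintype.sum_bijective _ (bijective_entries K) _
      (fun w : UpperPos K → F => ∏ p, θ (w p * f p.1.1 p.1.2)) (fun u => rfl),
    ← Fintype.prod_sum fun (p : UpperPos K) (t : F) => θ (t * f p.1.1 p.1.2),
    Finset.prod_congr rfl fun p _ => sum_apply_mul hθ (f p.1.1 p.1.2)]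
  split_ifs with h
  · rw [Finset.prod_congr rfl fun p _ => if_pos (h _ _ p.2.1 p.2.2.1 p.2.2.2), Finset.prod_const,
      Finset.card_univ]
  · push Not at h
    obtain ⟨j, k, hjk, hj, hk, hne⟩ := h
    rw [Finset.prod_eq_zero (Finset.mem_univ (⟨(j, k), hjk, hj, hk⟩ : UpperPos K))]
    rw [if_neg hne]

open Classical in
/-- The supercharacter as a sum of additive characters of `u - 1`. -/
lemma supercharacter_eq_sum [Fintype F] {θ : AddChar F ℂ} (hθ : θ ≠ 1) (lam : Finset (Arc ι F))
    (u : U ι F) :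
    ((Fintype.card F : ℂ) ^ Fintype.card ι) ^ lam.card * supercharacter θ lam u =
      ∑ z ∈ Fintype.piFinset fun a : lam =>
          pinned F (· < a.1.left) a.1.left ×ˢ pinned F (a.1.right < ·) a.1.right,
        θ (∑ j, ∑ k, (∑ a, a.1.label * (z a).1 j * (z a).2 k) * (toMat u - 1) j k) := by
  rw [supercharacter, ← Finset.prod_const, ← Finset.prod_mul_distrib,
    Finset.prod_congr rfl fun a _ => (arcSum_toMat_sub_one hθ a u).symm, ← Finset.prod_coe_sort]
  simp only [arcSum, ← Finset.sum_product']
  rw [Finset.prod_univ_sum]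
  refine Finset.sum_congr rfl fun z _ => ?_
  rw [← map_sum_eq_prod]
  congr 1
  simp only [dotProduct, Matrix.mulVec, Finset.mul_sum, Finset.sum_mul, Finset.sum_product]
  rw [Finset.sum_comm]
  refine Finset.sum_congr rfl fun j _ => ?_
  rw [Finset.sum_comm]
  exact Finset.sum_congr rfl fun k _ => Finset.sum_congr rfl fun a _ => by ring

/-- The trivial character occurs in the restriction of a supercharacter to `U_K` exactly if there is
a cancelling family of vectors. -/
lemma innerProd_res_ne_zero_iff [Finite F] {θ : AddChar F ℂ} (hθ : θ ≠ 1) (K : Set ι)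
    (lam : Finset (Arc ι F)) :
    innerProd (res (UK F K) (supercharacter θ lam)) (fun _ => 1) ≠ 0 ↔
      ∃ x y, IsCancelling K lam x y := by
  classical
  have := Fintype.ofFinite F
  have := Fintype.ofFinite (UK F K)
  set Z := Fintype.piFinset fun a : lam =>
    pinned F (· < a.1.left) a.1.left ×ˢ pinned F (a.1.right < ·) a.1.right with hZ
  -- `A` is the finite set of cancelling families; the inner product turns out to be a positive
  -- multiple of its cardinality.
  set A := Z.filter fun z => ∀ j k, j < k → j ∈ K → k ∈ K →
    ∑ a, a.1.label * (z a).1 j * (z a).2 k = 0 with hA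
  have hq : (Fintype.card F : ℂ) ≠ 0 := Nat.cast_ne_zero.2 Fintype.card_ne_zero
  have hsum : ((Fintype.card F : ℂ) ^ Fintype.card ι) ^ lam.card *
      ∑ u : UK F K, supercharacter θ lam u.1 =
        A.card * (Fintype.card F : ℂ) ^ Fintype.card (UpperPos K) := by
    rw [Finset.mul_sum, Finset.sum_congr rfl fun u _ => supercharacter_eq_sum hθ lam u.1,
      Finset.sum_comm, Finset.sum_congr rfl fun z _ => sum_UK_eq hθ K _, ← Finset.sum_filter,
      Finset.sum_const, nsmul_eq_mul]
  have hinner : innerProd (res (UK F K) (supercharacter θ lam)) (fun _ => 1) =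
      (Nat.card (UK F K) : ℂ)⁻¹ * ∑ u : UK F K, supercharacter θ lam u.1 := by
    rw [innerProd, finsum_eq_sum_of_fintype]
    simp [res]
  have hne : innerProd (res (UK F K) (supercharacter θ lam)) (fun _ => 1) ≠ 0 ↔ A.Nonempty := by
    have h1 : (Nat.card (UK F K) : ℂ)⁻¹ ≠ 0 := inv_ne_zero (Nat.cast_ne_zero.2 Nat.card_pos.ne')
    have h2 : ((Fintype.card F : ℂ) ^ Fintype.card ι) ^ lam.card ≠ 0 :=
      pow_ne_zero _ (pow_ne_zero _ hq)
    rw [hinner, mul_ne_zero_iff_left h1, ← mul_ne_zero_iff_left h2, hsum,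
      mul_ne_zero_iff_right (pow_ne_zero _ hq), Nat.cast_ne_zero, Finset.card_ne_zero]
  rw [hne]
  simp only [Finset.Nonempty, hA, hZ, Finset.mem_filter, Fintype.mem_piFinset, Finset.mem_product,
    mem_pinned_lt, mem_pinned_gt]
  constructor
  · rintro ⟨z, hz, hz0⟩
    exact ⟨fun a => (z a).1, fun a => (z a).2, fun a => (hz a).1.1, fun a => (hz a).1.2,
      fun a => (hz a).2.1, fun a => (hz a).2.2, hz0⟩
  · rintro ⟨x, y, h⟩
    exact ⟨fun a => (x a, y a), fun a => ⟨⟨h.left_one a, h.left_zero a⟩, h.right_one a,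
      h.right_zero a⟩, h.sum_eq_zero⟩

end Restriction

end Supercharacter

end

theorem theorem3p1 {F : Type*} [Field F] [Finite F]
    (θ : AddChar F ℂ) (hθ : θ ≠ 1)
    (K L : Finset ℕ+) (hKL : K ⊆ L)
    (lam : Finset (Supercharacter.Arc L F)) (hlam : Supercharacter.IsQSetPartition lam) :
    Supercharacter.innerProd
        (Supercharacter.res (Supercharacter.UK F {i : L | (i : ℕ+) ∈ K})
          (Supercharacter.supercharacter θ lam))
        (fun _ => 1) ≠ 0 ↔
      Supercharacter.HasCompleteMatching {i : L | (i : ℕ+) ∈ K} lam := by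
  rw [Supercharacter.innerProd_res_ne_zero_iff hθ, Supercharacter.hasCompleteMatching_iff]
  constructor
  · rintro ⟨x, y, h⟩
    exact h.exists_injective hlam
  · rintro ⟨f, hf, hadj⟩
    exact Supercharacter.exists_isCancelling f hf hadj
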